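/- Throughout, rings are associative with identity, not necessarily commutative, and $J(R)$ denotes the Jacobson radical of a ring $R$. An element $p\in R$ is potent if $p=p^m$ for some integer $m\ge 2$. The ring $R$ is J-clean-like if for every $a\in R$ there exists a potent $p\in R$ such that $a-p\in J(R)$. A ring $S$ is periodic if for every $a\in S$ there exist distinct positive integers $m,n$ with $a^m=a^n$. The ring $R$ is right (respectively, left) quasi-duo if every maximal right (respectively, left) ideal of $R$ is a two-sided ideal. Every potent element lifts modulo $J(R)$ if, for every $p\in R$ such that $p-p^n\in J(R)$ for some integer $n\ge 2$, there exists a potent $q\in R$ with $p-q\in J(R)$. **Theorem 4.8.** Let $R$ be a ring. Then $R$ is J-clean-like if and only if the following three conditions hold: 1. $R/J(R)$ is periodic; 2. $R$ is right quasi-duo; 3. every potent element lifts modulo $J(R)$. The same equivalence holds with "right quasi-duo" replaced by "left quasi-duo" in condition 2. -/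

import Mathlib

/-- An element `p` of a ring is potent if `p = p ^ m` for some `m ≥ 2`. -/
def IsPotentElement {R : Type*} [Ring R] (p : R) : Prop :=
  ∃ m : ℕ, 2 ≤ m ∧ p = p ^ m

/-- A ring is periodic if for every `a` there are distinct positive integers `m`, `n` with
`a ^ m = a ^ n`. -/
def IsPeriodicRing (R : Type*) [Ring R] : Prop :=
  ∀ a : R, ∃ m n : ℕ, 0 < m ∧ 0 < n ∧ m ≠ n ∧ a ^ m = a ^ n

/-- A ring is J-clean-like if every element differs from a potent element by an element of the
Jacobson radical. -/
def IsJCleanLike (R : Type*) [Ring R] : Prop :=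
  ∀ a : R, ∃ p : R, IsPotentElement p ∧ a - p ∈ Ring.jacobson R

/-- An element `p` is J-potent if `p - p ^ n` lies in the Jacobson radical for some `n ≥ 2`. -/
def IsJPotentElement {R : Type*} [Ring R] (p : R) : Prop :=
  ∃ n : ℕ, 2 ≤ n ∧ p - p ^ n ∈ Ring.jacobson R

/-- Every potent element lifts modulo the Jacobson radical: each J-potent element is congruent
modulo the Jacobson radical to a potent element. -/
def PotentsLiftModJacobson (R : Type*) [Ring R] : Prop :=
  ∀ p : R, IsJPotentElement p → ∃ q : R, IsPotentElement q ∧ p - q ∈ Ring.jacobson R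

/-- A ring is left quasi-duo if every maximal left ideal is a two-sided ideal.
(`Ideal R` is the type of left ideals of `R`.) -/
def IsLeftQuasiDuo (R : Type*) [Ring R] : Prop :=
  ∀ M : Ideal R, M.IsMaximal → M.IsTwoSided

/-- A ring is right quasi-duo if every maximal right ideal is a two-sided ideal. Right ideals are
the submodules of `R` as a right module over itself, that is, as a module over `Rᵐᵒᵖ`; the maximal
ones are the coatoms of their lattice. -/
def IsRightQuasiDuo (R : Type*) [Ring R] : Prop :=
  ∀ M : Submodule Rᵐᵒᵖ R, IsCoatom M → ∀ r x : R, x ∈ M → r * x ∈ M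

section CompletelyPrime

variable {R : Type*} [Ring R]

/-! If `R` is J-clean-like, every element of `R/J` is potent, so `R/J` is reduced with central
idempotents; hence its one-sided ideals are two-sided, and `R` is quasi-duo because maximal
one-sided ideals contain `J`. Conversely, a two-sided maximal one-sided ideal is completely prime,
so periodicity modulo `J` yields `a - a ^ (k + 1) ∈ M` with `k` independent of `M`. Intersecting
over `M` makes `a` J-potent, and lifting finishes. -/

theorem Ideal.mem_or_mem_of_isMaximal_of_isTwoSided (M : Ideal R) (hM : M.IsMaximal)
    (hT : M.IsTwoSided) {a b : R} (hab : a * b ∈ M) : a ∈ M ∨ b ∈ M := by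
  by_contra! h
  obtain ⟨s, m, hm, hs⟩ := hM.exists_inv h.1
  refine h.2 ?_
  have : b = s * (a * b) + m * b := by
    rw [← mul_assoc, ← add_mul, hs, one_mul]
  rw [this]
  exact M.add_mem (M.mul_mem_left s hab) (M.mul_mem_right b hm)

theorem Submodule.exists_mul_add_eq_one_of_isCoatom {M : Submodule Rᵐᵒᵖ R} (hM : IsCoatom M)
    {a : R} (ha : a ∉ M) : ∃ s, ∃ m ∈ M, a * s + m = 1 := by
  have htop : Submodule.span Rᵐᵒᵖ {a} ⊔ M = ⊤ := by
    refine hM.2 _ (lt_of_le_of_ne le_sup_right fun h => ha ?_)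
    rw [h]
    exact (le_sup_left : _ ≤ Submodule.span Rᵐᵒᵖ {a} ⊔ M) (Submodule.mem_span_singleton_self a)
  have h1 : (1 : R) ∈ Submodule.span Rᵐᵒᵖ {a} ⊔ M := htop ▸ Submodule.mem_top
  obtain ⟨y, hy, m, hm, h⟩ := Submodule.mem_sup.1 h1
  obtain ⟨s, rfl⟩ := Submodule.mem_span_singleton.1 hy
  exact ⟨s.unop, m, hm, h⟩

theorem Submodule.mul_mem_of_mem {M : Submodule Rᵐᵒᵖ R} {a : R} (ha : a ∈ M) (r : R) :
    a * r ∈ M :=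
  M.smul_mem (MulOpposite.op r) ha

theorem Submodule.eq_top_of_one_mem {M : Submodule Rᵐᵒᵖ R} (h : (1 : R) ∈ M) : M = ⊤ :=
  eq_top_iff.2 fun x _ => by simpa using Submodule.mul_mem_of_mem h x

theorem Submodule.mem_or_mem_of_isCoatom {M : Submodule Rᵐᵒᵖ R} (hM : IsCoatom M)
    (hT : ∀ r x : R, x ∈ M → r * x ∈ M) {a b : R} (hab : a * b ∈ M) : a ∈ M ∨ b ∈ M := by
  by_contra! h
  obtain ⟨s, m, hm, hs⟩ := Submodule.exists_mul_add_eq_one_of_isCoatom hM h.2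
  refine h.1 ?_
  have : a = a * b * s + a * m := by
    rw [mul_assoc, ← mul_add, hs, mul_one]
  rw [this]
  exact M.add_mem (Submodule.mul_mem_of_mem hab s) (hT a m hm)

/-- If `M` is a completely prime two-sided ideal and `a ^ m ≡ a ^ (m + k)` modulo `M`, then
`a ≡ a ^ (k + 1)` modulo `M`. -/
theorem sub_pow_succ_mem_of_completelyPrime (M : AddSubgroup R)
    (hleft : ∀ r x : R, x ∈ M → r * x ∈ M) (hright : ∀ r x : R, x ∈ M → x * r ∈ M)
    (hprime : ∀ a b : R, a * b ∈ M → a ∈ M ∨ b ∈ M) {a : R} {m k : ℕ}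
    (h : a ^ m - a ^ (m + k) ∈ M) : a - a ^ (k + 1) ∈ M := by
  -- Primality strips one factor `a` at a time; the claim is immediate once `a` or `1 - a ^ k` lies
  -- in `M`.
  have key : ∀ j : ℕ, a ^ j * (1 - a ^ k) ∈ M → a - a ^ (k + 1) ∈ M := by
    intro j
    induction j with
    | zero =>
      intro hj
      simpa [mul_sub, pow_succ'] using hleft a _ hj
    | succ j ih =>
      intro hj
      rw [pow_succ', mul_assoc] at hj
      rcases hprime _ _ hj with ha | hj
      · simpa [mul_sub, pow_succ'] using hright (1 - a ^ k) _ ha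
      · exact ih hj
  exact key m (by rwa [mul_sub, mul_one, ← pow_add])

end CompletelyPrime

section JacobsonRadical

variable {R : Type*} [Ring R]

theorem Ring.exists_mul_one_sub_eq_one {x : R} (hx : x ∈ Ring.jacobson R) :
    ∃ u, u * (1 - x) = 1 := by
  by_contra! h
  have hne : Ideal.span {1 - x} ≠ ⊤ := fun ht => by
    obtain ⟨u, hu⟩ := Ideal.mem_span_singleton'.1 ((Ideal.eq_top_iff_one _).1 ht)
    exact h u hu
  obtain ⟨M, hM, hle⟩ := Ideal.exists_le_maximal _ hne
  refine hM.ne_top ((Ideal.eq_top_iff_one _).2 ?_)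
  have := M.add_mem (hle (Ideal.mem_span_singleton_self _)) (Ring.jacobson_le_of_isMaximal M hx)
  simpa using this

theorem Ring.isUnit_one_sub_of_mem_jacobson {x : R} (hx : x ∈ Ring.jacobson R) :
    IsUnit (1 - x) := by
  obtain ⟨u, hu⟩ := Ring.exists_mul_one_sub_eq_one hx
  -- The left inverse again has the form `1 - j` with `j ∈ J`, so it too has a left inverse.
  have hu' : u = 1 - -(u * x) := by
    rw [sub_neg_eq_add, ← hu, mul_sub, mul_one, sub_add_cancel]
  obtain ⟨v, hv⟩ := Ring.exists_mul_one_sub_eq_one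
    ((Ring.jacobson R).neg_mem ((Ring.jacobson R).mul_mem_left u hx))
  rw [← hu'] at hv
  have hvx : v = 1 - x := left_inv_eq_right_inv hv hu
  exact ⟨⟨1 - x, u, hvx ▸ hv, hu⟩, rfl⟩

/-- Half of the left-right symmetry of the radical, which is defined through left ideals. -/
theorem Ring.mem_of_mem_jacobson_of_isCoatom {M : Submodule Rᵐᵒᵖ R} (hM : IsCoatom M) {x : R}
    (hx : x ∈ Ring.jacobson R) : x ∈ M := by
  by_contra h
  obtain ⟨s, m, hm, hs⟩ := Submodule.exists_mul_add_eq_one_of_isCoatom hM h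
  obtain ⟨v, hv⟩ := (Ring.isUnit_one_sub_of_mem_jacobson
    ((Ring.jacobson R).mul_mem_right s hx)).exists_right_inv
  rw [← hs, add_sub_cancel_left] at hv
  exact hM.1 (Submodule.eq_top_of_one_mem (hs ▸ hv ▸ Submodule.mul_mem_of_mem hm v))

theorem exists_one_sub_mul_eq_one_of_forall_isCoatom {x : R}
    (hx : ∀ M : Submodule Rᵐᵒᵖ R, IsCoatom M → x ∈ M) : ∃ u, (1 - x) * u = 1 := by
  by_contra! h
  have hne : Submodule.span Rᵐᵒᵖ {1 - x} ≠ ⊤ := fun ht => by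
    have h1 : (1 : R) ∈ Submodule.span Rᵐᵒᵖ {1 - x} := ht ▸ Submodule.mem_top
    obtain ⟨u, hu⟩ := Submodule.mem_span_singleton.1 h1
    exact h u.unop hu
  have hfin : Module.Finite Rᵐᵒᵖ R := ⟨⟨{1}, Submodule.eq_top_of_one_mem (by
    simp)⟩⟩
  obtain ⟨M, hM, hle⟩ := (eq_top_or_exists_le_coatom (Submodule.span Rᵐᵒᵖ {1 - x})).resolve_left hne
  refine hM.1 (Submodule.eq_top_of_one_mem ?_)
  have := M.add_mem (hle (Submodule.mem_span_singleton_self _)) (hx M hM)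
  simpa using this

/-- The other half of the symmetry; quasi-duo keeps `r * x` in every maximal right ideal, so `1 - r
* x` is a unit. -/
theorem IsRightQuasiDuo.mem_jacobson (hR : IsRightQuasiDuo R) {x : R}
    (hx : ∀ M : Submodule Rᵐᵒᵖ R, IsCoatom M → x ∈ M) : x ∈ Ring.jacobson R := by
  rw [Ring.jacobson_eq_sInf_isMaximal]
  refine Submodule.mem_sInf.2 fun (M : Ideal R) (hM : M.IsMaximal) => ?_
  by_contra h
  obtain ⟨r, m, hm, hr⟩ := hM.exists_inv h
  have hrx : ∀ N : Submodule Rᵐᵒᵖ R, IsCoatom N → r * x ∈ N := fun N hN => hR N hN r x (hx N hN)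
  obtain ⟨u, hu⟩ := exists_one_sub_mul_eq_one_of_forall_isCoatom hrx
  have hu' : u = 1 - -(r * x * u) := by
    rw [sub_neg_eq_add, ← hu, sub_mul, one_mul, sub_add_cancel]
  obtain ⟨v, hv⟩ := exists_one_sub_mul_eq_one_of_forall_isCoatom (x := -(r * x * u))
    fun N hN => N.neg_mem (Submodule.mul_mem_of_mem (hrx N hN) u)
  rw [← hu'] at hv
  have hvx : 1 - r * x = v := left_inv_eq_right_inv hu hv
  rw [← hvx, ← hr, add_sub_cancel_left, hr] at hv
  exact hM.ne_top ((Ideal.eq_top_iff_one _).2 (hv ▸ M.mul_mem_left u hm))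

end JacobsonRadical

section PotentRings

variable {S : Type*} [Ring S]

/-- Both `e * x * (1 - e)` and `(1 - e) * x * e` square to zero. -/
theorem IsIdempotentElem.commute_of_isReduced [IsReduced S] {e : S} (he : IsIdempotentElem e)
    (x : S) : e * x = x * e := by
  have h1 : e * x - e * x * e = 0 := by
    refine pow_eq_zero_iff two_ne_zero |>.1 ?_
    have : (e * x - e * x * e) * e = 0 := by
      rw [sub_mul, mul_assoc (e * x) e e, he.eq, sub_self]
    calc (e * x - e * x * e) ^ 2 = (e * x - e * x * e) * e * (x - x * e) := by noncomm_ring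
      _ = 0 := by rw [this, zero_mul]
  have h2 : x * e - e * x * e = 0 := by
    refine pow_eq_zero_iff two_ne_zero |>.1 ?_
    have : e * (x * e - e * x * e) = 0 := by
      rw [mul_sub, mul_assoc e x e, ← mul_assoc e e, he.eq, sub_self]
    calc (x * e - e * x * e) ^ 2 = (x - e * x) * (e * (x * e - e * x * e)) := by noncomm_ring
      _ = 0 := by rw [this, mul_zero]
  rw [sub_eq_zero.1 h1, sub_eq_zero.1 h2]

theorem isReduced_of_forall_isPotentElement (hS : ∀ a : S, IsPotentElement a) : IsReduced S := by
  rw [isReduced_iff_pow_one_lt 2 one_lt_two]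
  intro a ha
  obtain ⟨m, hm, h⟩ := hS a
  rw [h]
  exact pow_eq_zero_of_le hm ha

theorem IsPotentElement.exists_isIdempotentElem {a : S} (ha : IsPotentElement a) :
    ∃ k : ℕ, IsIdempotentElem (a ^ (k + 1)) ∧ a ^ (k + 1) * a = a ∧ a * a ^ (k + 1) = a := by
  obtain ⟨m, hm, h⟩ := ha
  obtain ⟨k, rfl⟩ := Nat.exists_eq_add_of_le' hm
  have h1 : a ^ (k + 1) * a = a := by rw [← pow_succ, ← h]
  refine ⟨k, ?_, h1, by rw [← pow_succ', ← h]⟩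
  rw [IsIdempotentElem]
  nth_rw 2 [pow_succ']
  rw [← mul_assoc, h1, ← pow_succ']

/-- The idempotent `e = a ^ (k + 1)` is central and fixes `a`, so it can be moved across `r` and a
factor `a` split off. -/
theorem exists_mul_eq_mul_of_forall_isPotentElement (hS : ∀ a : S, IsPotentElement a) (a r : S) :
    (∃ s, a * r = s * a) ∧ ∃ s, r * a = a * s := by
  have := isReduced_of_forall_isPotentElement hS
  obtain ⟨k, he, hl, hr⟩ := (hS a).exists_isIdempotentElem
  constructor
  · refine ⟨a * r * a ^ k, ?_⟩
    rw [mul_assoc (a * r), ← pow_succ, ← he.commute_of_isReduced, ← mul_assoc, hl]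
  · refine ⟨a ^ k * (r * a), ?_⟩
    rw [← mul_assoc, ← pow_succ', he.commute_of_isReduced, mul_assoc, hr]

end PotentRings

section JCleanLike

variable {R : Type*} [Ring R]

theorem IsJCleanLike.isPotentElement_quotient (hR : IsJCleanLike R) (a : R ⧸ Ring.jacobson R) :
    IsPotentElement a := by
  obtain ⟨a, rfl⟩ := Ideal.Quotient.mk_surjective a
  obtain ⟨p, ⟨m, hm, hp⟩, h⟩ := hR a
  exact ⟨m, hm, by rw [Ideal.Quotient.eq.2 h, ← map_pow, ← hp]⟩

theorem IsJCleanLike.isPeriodicRing_quotient (hR : IsJCleanLike R) :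
    IsPeriodicRing (R ⧸ Ring.jacobson R) := by
  intro a
  obtain ⟨m, hm, h⟩ := hR.isPotentElement_quotient a
  exact ⟨1, m, one_pos, by omega, by omega, by rwa [pow_one]⟩

theorem IsJCleanLike.potentsLiftModJacobson (hR : IsJCleanLike R) : PotentsLiftModJacobson R :=
  fun p _ => hR p

theorem IsJCleanLike.isLeftQuasiDuo (hR : IsJCleanLike R) : IsLeftQuasiDuo R := by
  refine fun M hM => ⟨fun {a} r ha => ?_⟩
  obtain ⟨s, hs⟩ := (exists_mul_eq_mul_of_forall_isPotentElement hR.isPotentElement_quotient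
    (Ideal.Quotient.mk _ a) (Ideal.Quotient.mk _ r)).1
  obtain ⟨s, rfl⟩ := Ideal.Quotient.mk_surjective s
  rw [← map_mul, ← map_mul, Ideal.Quotient.eq] at hs
  have := M.add_mem (Ring.jacobson_le_of_isMaximal M hs) (M.mul_mem_left s ha)
  rwa [sub_add_cancel] at this

theorem IsJCleanLike.isRightQuasiDuo (hR : IsJCleanLike R) : IsRightQuasiDuo R := by
  intro M hM r a ha
  obtain ⟨s, hs⟩ := (exists_mul_eq_mul_of_forall_isPotentElement hR.isPotentElement_quotient
    (Ideal.Quotient.mk _ a) (Ideal.Quotient.mk _ r)).2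
  obtain ⟨s, rfl⟩ := Ideal.Quotient.mk_surjective s
  rw [← map_mul, ← map_mul, Ideal.Quotient.eq] at hs
  have := M.add_mem (Ring.mem_of_mem_jacobson_of_isCoatom hM hs) (Submodule.mul_mem_of_mem ha s)
  rwa [sub_add_cancel] at this

theorem IsPeriodicRing.exists_pow_sub_pow_mem_jacobson
    (hR : IsPeriodicRing (R ⧸ Ring.jacobson R)) (a : R) :
    ∃ m k : ℕ, 0 < k ∧ a ^ m - a ^ (m + k) ∈ Ring.jacobson R := by
  obtain ⟨m, n, -, -, hmn, h⟩ := hR (Ideal.Quotient.mk _ a)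
  wlog hlt : m < n generalizing m n
  · exact this n m hmn.symm h.symm (by omega)
  refine ⟨m, n - m, by omega, ?_⟩
  rwa [Nat.add_sub_cancel' hlt.le, ← Ideal.Quotient.eq, map_pow, map_pow]

theorem IsPeriodicRing.isJPotentElement_of_isLeftQuasiDuo
    (hR : IsPeriodicRing (R ⧸ Ring.jacobson R)) (hduo : IsLeftQuasiDuo R) (a : R) :
    IsJPotentElement a := by
  obtain ⟨m, k, hk, h⟩ := hR.exists_pow_sub_pow_mem_jacobson a
  -- The exponent is chosen before `M`, so one power serves all maximal ideals.
  refine ⟨k + 1, by omega, ?_⟩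
  rw [Ring.jacobson_eq_sInf_isMaximal]
  refine Submodule.mem_sInf.2 fun (M : Ideal R) (hM : M.IsMaximal) => ?_
  have hT := hduo M hM
  exact sub_pow_succ_mem_of_completelyPrime M.toAddSubgroup (fun r _ hx => M.mul_mem_left r hx)
    (fun r _ hx => M.mul_mem_right r hx)
    (fun _ _ => M.mem_or_mem_of_isMaximal_of_isTwoSided hM hT)
    (Ring.jacobson_le_of_isMaximal M h)

theorem IsPeriodicRing.isJPotentElement_of_isRightQuasiDuo
    (hR : IsPeriodicRing (R ⧸ Ring.jacobson R)) (hduo : IsRightQuasiDuo R) (a : R) :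
    IsJPotentElement a := by
  obtain ⟨m, k, hk, h⟩ := hR.exists_pow_sub_pow_mem_jacobson a
  refine ⟨k + 1, by omega, hduo.mem_jacobson fun M hM => ?_⟩
  exact sub_pow_succ_mem_of_completelyPrime M.toAddSubgroup (hduo M hM)
    (fun r _ hx => Submodule.mul_mem_of_mem hx r)
    (fun _ _ => Submodule.mem_or_mem_of_isCoatom hM (hduo M hM))
    (Ring.mem_of_mem_jacobson_of_isCoatom hM h)

end JCleanLike

theorem theorem4p8 (R : Type*) [Ring R] :
    (IsJCleanLike R ↔
      IsPeriodicRing (R ⧸ Ring.jacobson R) ∧ IsRightQuasiDuo R ∧ PotentsLiftModJacobson R) ∧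
    (IsJCleanLike R ↔
      IsPeriodicRing (R ⧸ Ring.jacobson R) ∧ IsLeftQuasiDuo R ∧ PotentsLiftModJacobson R) :=
  ⟨⟨fun h => ⟨h.isPeriodicRing_quotient, h.isRightQuasiDuo, h.potentsLiftModJacobson⟩,
    fun ⟨hper, hduo, hlift⟩ a => hlift a (hper.isJPotentElement_of_isRightQuasiDuo hduo a)⟩,
  ⟨fun h => ⟨h.isPeriodicRing_quotient, h.isLeftQuasiDuo, h.potentsLiftModJacobson⟩,
    fun ⟨hper, hduo, hlift⟩ a => hlift a (hper.isJPotentElement_of_isLeftQuasiDuo hduo a)⟩⟩
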